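/- Let $d\ge 1$, and let $P_+=|\Phi_+\rangle\langle\Phi_+|$, $|\Phi_+\rangle=d^{-1/2}\sum_{i=1}^{d}|i\rangle\otimes|i\rangle$, be the maximally entangled state on $\mathbb C^d\otimes\mathbb C^d$. For a bipartite state (density operator) $\rho$ on $\mathbb C^{a}\otimes\mathbb C^{b}$ define the single distance $$\Delta(P_+,\rho)=\inf_{P}\,\|P_+-P(\rho)\|_1,$$ where $\|\cdot\|_1$ is the trace norm and the infimum is over all (deterministic) LOCC protocols $P$ from $\mathbb C^{a}\otimes\mathbb C^{b}$ to $\mathbb C^d\otimes\mathbb C^d$. For real $n,m\ge 0$ let $$E^{PPT}_{n:m}(\rho)=\max\Big\{0,\,-\min_{W}\operatorname{Tr}(W\rho)\Big\},$$ where $W$ ranges over the decomposable entanglement witnesses on $\mathbb C^{a}\otimes\mathbb C^{b}$ (Hermitian operators, non-negative in expectation on all product vectors, of the form $W=P+Q_1^{T_A}+Q_2^{T_B}$ with $P,Q_1,Q_2\ge 0$ and $T_A,T_B$ the partial transpositions) that satisfy $-nI\le W\le mI$. Then for every state $\rho$ and every real $n\ge d$, $$\Delta(P_+,\rho)\;\ge\;2\left(1-\frac{1+E^{PPT}_{n:1}(\rho)}{d}\right).$$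 -/

import Mathlib

open scoped Kronecker ComplexOrder

/-! ### States of a bipartite system -/

/-- Density operators: positive semidefinite matrices of unit trace. -/
def IsDensity {ι : Type*} [Fintype ι] (ρ : Matrix ι ι ℂ) : Prop :=
  ρ.PosSemidef ∧ ρ.trace = 1

/-- Partial transposition with respect to the first party. -/
def partialTransposeA {α β : Type*} (X : Matrix (α × β) (α × β) ℂ) :
    Matrix (α × β) (α × β) ℂ :=
  Matrix.of fun p q => X (q.1, p.2) (p.1, q.2)

/-- Partial transposition with respect to the second party. -/
def partialTransposeB {α β : Type*} (X : Matrix (α × β) (α × β) ℂ) :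
    Matrix (α × β) (α × β) ℂ :=
  Matrix.of fun p q => X (p.1, q.2) (q.1, p.2)

/-- The product vector `ψ ⊗ φ`. -/
def productVec {α β : Type*} (ψ : α → ℂ) (φ : β → ℂ) : α × β → ℂ :=
  fun p => ψ p.1 * φ p.2

/-! ### Entanglement witnesses and the measure `E^{PPT}_{n:m}` -/

/-- Bipartite entanglement witnesses: Hermitian operators with non-negative expectation in every
product vector. -/
def IsWitness {α β : Type*} [Fintype α] [Fintype β] (W : Matrix (α × β) (α × β) ℂ) : Prop :=
  W.IsHermitian ∧ ∀ (ψ : α → ℂ) (φ : β → ℂ),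
    0 ≤ (star (productVec ψ φ) ⬝ᵥ W.mulVec (productVec ψ φ)).re

/-- Decomposable operators: `W = P + Q₁^{T_A} + Q₂^{T_B}` with `P, Q₁, Q₂` positive
semidefinite. -/
def IsDecomposable {α β : Type*} [Fintype α] [Fintype β]
    (W : Matrix (α × β) (α × β) ℂ) : Prop :=
  ∃ P Q₁ Q₂ : Matrix (α × β) (α × β) ℂ, P.PosSemidef ∧ Q₁.PosSemidef ∧ Q₂.PosSemidef ∧
    W = P + partialTransposeA Q₁ + partialTransposeB Q₂

/-- The decomposable entanglement witnesses `W` with `-n I ≤ W ≤ m I`. -/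
def pptWitnessSet (α β : Type*) [Fintype α] [Fintype β] [DecidableEq α] [DecidableEq β]
    (n m : ℝ) : Set (Matrix (α × β) (α × β) ℂ) :=
  {W | IsWitness W ∧ IsDecomposable W ∧
    (W + (n : ℂ) • (1 : Matrix (α × β) (α × β) ℂ)).PosSemidef ∧
    ((m : ℂ) • (1 : Matrix (α × β) (α × β) ℂ) - W).PosSemidef}

/-- `E^{PPT}_{n:m}(ρ) = max {0, - min_W Tr (W ρ)}`, over the decomposable entanglement witnesses
with `-n I ≤ W ≤ m I` (for `n, m ≥ 0` this is a compact set that contains `0`). -/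
noncomputable def EPPT {α β : Type*} [Fintype α] [Fintype β] [DecidableEq α] [DecidableEq β]
    (n m : ℝ) (ρ : Matrix (α × β) (α × β) ℂ) : ℝ :=
  max 0 (-sInf ((fun W => (W * ρ).trace.re) '' pptWitnessSet α β n m))

/-! ### LOCC protocols -/

/-- Deterministic LOCC protocols (with finitely many rounds and outcomes) from
`ℂ^a ⊗ ℂ^b` to `ℂ^d ⊗ ℂ^e`.
A protocol either stops, or one of the parties performs a complete local measurement with Kraus
operators `K i`, `∑ i, (K i)ᴴ * K i = 1`, whose output space may have any finite dimension `c i`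
(local ancillas may be added or discarded), and announces the outcome `i`, on which
the rest `next i` of the protocol may depend. -/
inductive LOCCProtocol (d e : ℕ) : ℕ → ℕ → Type
  | halt : LOCCProtocol d e d e
  | alice {a b : ℕ} (r : ℕ) (c : Fin r → ℕ) (K : (i : Fin r) → Matrix (Fin (c i)) (Fin a) ℂ)
      (hK : ∑ i, (K i).conjTranspose * K i = 1)
      (next : (i : Fin r) → LOCCProtocol d e (c i) b) : LOCCProtocol d e a b
  | bob {a b : ℕ} (r : ℕ) (c : Fin r → ℕ) (K : (i : Fin r) → Matrix (Fin (c i)) (Fin b) ℂ)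
      (hK : ∑ i, (K i).conjTranspose * K i = 1)
      (next : (i : Fin r) → LOCCProtocol d e a (c i)) : LOCCProtocol d e a b

/-- The final state of the protocol (averaged over all measurement outcomes) on the initial
state `X`. -/
noncomputable def LOCCProtocol.apply {d e : ℕ} : {a b : ℕ} → LOCCProtocol d e a b →
    Matrix (Fin a × Fin b) (Fin a × Fin b) ℂ → Matrix (Fin d × Fin e) (Fin d × Fin e) ℂ
  | _, _, .halt, X => X
  | _, b, .alice _ _ K _ next, X => ∑ i, (next i).apply
      ((K i ⊗ₖ (1 : Matrix (Fin b) (Fin b) ℂ)) * X *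
        (K i ⊗ₖ (1 : Matrix (Fin b) (Fin b) ℂ)).conjTranspose)
  | a, _, .bob _ _ K _ next, X => ∑ i, (next i).apply
      (((1 : Matrix (Fin a) (Fin a) ℂ) ⊗ₖ K i) * X *
        ((1 : Matrix (Fin a) (Fin a) ℂ) ⊗ₖ K i).conjTranspose)

/-! ### The single distance -/

/-- The trace norm `‖X‖₁ = Tr √(Xᴴ X)`, i.e. the sum of the singular values of `X`. -/
noncomputable def traceNorm {ι : Type*} [Fintype ι] [DecidableEq ι] (X : Matrix ι ι ℂ) : ℝ :=
  ∑ i, √((Matrix.isHermitian_conjTranspose_mul_self X).eigenvalues i)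

/-- The maximally entangled vector `d^{-1/2} ∑ i, |i⟩ ⊗ |i⟩` of `ℂ^d ⊗ ℂ^d`. -/
noncomputable def maxEntangledVec (d : ℕ) : Fin d × Fin d → ℂ :=
  fun p => if p.1 = p.2 then ((1 / √(d : ℝ) : ℝ) : ℂ) else 0

/-- The maximally entangled state `P₊ = |Φ₊⟩⟨Φ₊|` on `ℂ^d ⊗ ℂ^d`. -/
noncomputable def maxEntangled (d : ℕ) : Matrix (Fin d × Fin d) (Fin d × Fin d) ℂ :=
  Matrix.vecMulVec (maxEntangledVec d) (star (maxEntangledVec d))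

/-- The single distance `Δ(P₊, ρ) = inf_P ‖P₊ - P(ρ)‖₁`, the infimum over all LOCC protocols `P`
from `ℂ^a ⊗ ℂ^b` to `ℂ^d ⊗ ℂ^d`. -/
noncomputable def singleDistance (d : ℕ) {a b : ℕ}
    (ρ : Matrix (Fin a × Fin b) (Fin a × Fin b) ℂ) : ℝ :=
  ⨅ P : LOCCProtocol d d a b, traceNorm (maxEntangled d - P.apply ρ)

/-! Work in the Heisenberg picture. Since `P₊` is a rank-one projection, testing with the unitary
`2P₊ - 1` gives `‖P₊ - P(ρ)‖₁ ≥ 2(1 - Tr(P₊ P(ρ)))`, so it suffices to bound the fidelity `Tr(P₊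
P(ρ)) = Tr(P†(P₊) ρ)` for each protocol. The operator `1 - d P₊` is the partial transpose of `1 - F
≥ 0`, with `F` the flip. The adjoint `P†` is positive, unital and preserves the cone of partial
transposes of positive operators, so `W = P†(1 - d P₊) = 1 - d P†(P₊)` is a decomposable witness
with `(1 - d) I ≤ W ≤ I`. It is therefore admissible in `E_{n:1}`, and `-Tr(Wρ) ≤ E_{n:1}(ρ)` is the
required fidelity bound. -/

open Matrix

/-! ### The trace norm -/

/-- A matrix `Y` with the same modulus as `X` has `Re Tr Y ≤ ‖X‖₁`. -/
theorem re_trace_le_traceNorm {ι : Type*} [Fintype ι] [DecidableEq ι] {X Y : Matrix ι ι ℂ}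
    (h : Y.conjTranspose * Y = X.conjTranspose * X) : Y.trace.re ≤ traceNorm X := by
  set hX := Matrix.isHermitian_conjTranspose_mul_self X
  -- The trace is taken in an eigenbasis of `Xᴴ X = Yᴴ Y`, where `‖Y v‖` is the singular value
  -- belonging to `v`; Cauchy–Schwarz then bounds each diagonal entry.
  have htr : Y.trace = ∑ i, star (hX.eigenvectorBasis i).ofLp ⬝ᵥ
      Y.mulVec (hX.eigenvectorBasis i).ofLp := by
    have h1 := LinearMap.trace_eq_sum_inner (Matrix.toEuclideanLin Y) hX.eigenvectorBasis
    rw [Matrix.toEuclideanLin, Matrix.toLpLin_eq_toLin, Matrix.trace_toLin_eq] at h1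
    rw [h1]
    refine Finset.sum_congr rfl fun i _ => ?_
    rw [EuclideanSpace.inner_eq_star_dotProduct, dotProduct_comm]
    rfl
  rw [htr, Complex.re_sum]
  refine Finset.sum_le_sum fun i _ => ?_
  set v := hX.eigenvectorBasis i with hv
  have hn : ‖(WithLp.toLp 2 (Y.mulVec v.ofLp) : EuclideanSpace ℂ ι)‖ = √(hX.eigenvalues i) := by
    have h1 : star v.ofLp ⬝ᵥ (X.conjTranspose * X).mulVec v.ofLp =
        star (Y.mulVec v.ofLp) ⬝ᵥ Y.mulVec v.ofLp := by
      rw [← h, ← Matrix.mulVec_mulVec, Matrix.dotProduct_mulVec, Matrix.vecMul_conjTranspose,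
        star_star]
    rw [hX.eigenvalues_eq, h1, norm_eq_sqrt_re_inner (𝕜 := ℂ),
      EuclideanSpace.inner_eq_star_dotProduct, dotProduct_comm]
  calc (star v.ofLp ⬝ᵥ Y.mulVec v.ofLp).re
      = (inner ℂ v (WithLp.toLp 2 (Y.mulVec v.ofLp) : EuclideanSpace ℂ ι)).re := by
        rw [EuclideanSpace.inner_eq_star_dotProduct, dotProduct_comm]
    _ ≤ ‖v‖ * ‖(WithLp.toLp 2 (Y.mulVec v.ofLp) : EuclideanSpace ℂ ι)‖ :=
        re_inner_le_norm (𝕜 := ℂ) _ _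
    _ = √(hX.eigenvalues i) := by rw [hn, hv, hX.eigenvectorBasis.norm_eq_one, one_mul]

/-- For a projection `P` of unit trace and `σ` of unit trace, `‖P - σ‖₁ ≥ 2 (1 - Tr (P σ))`. -/
theorem two_mul_one_sub_le_traceNorm {ι : Type*} [Fintype ι] [DecidableEq ι]
    {P σ : Matrix ι ι ℂ} (hP : P.IsHermitian) (hPP : P * P = P) (htP : P.trace = 1)
    (htσ : σ.trace = 1) : 2 * (1 - (P * σ).trace.re) ≤ traceNorm (P - σ) := by
  -- The reflection `2P - 1` is unitary, so multiplying `P - σ` by it keeps the modulus; the trace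
  -- of the product is `2(1 - Tr(Pσ))`.
  have hU : ((2 : ℂ) • P - 1).conjTranspose * ((2 : ℂ) • P - 1) = 1 := by
    rw [conjTranspose_sub, conjTranspose_smul, hP.eq, conjTranspose_one]
    simp only [sub_mul, mul_sub, smul_mul_assoc, mul_smul_comm, hPP, mul_one, one_mul,
      star_ofNat]
    module
  have h := re_trace_le_traceNorm (X := P - σ) (Y := ((2 : ℂ) • P - 1) * (P - σ)) (by
    rw [conjTranspose_mul, Matrix.mul_assoc, ← Matrix.mul_assoc _ _ (P - σ), hU, one_mul])
  refine le_trans (le_of_eq ?_) h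
  simp only [sub_mul, mul_sub, smul_mul_assoc, hPP, one_mul, trace_sub, trace_smul, htP, htσ]
  simp

/-! ### Partial transposition -/

section PartialTranspose

variable {α β : Type*}

theorem partialTransposeB_isHermitian {Q : Matrix (α × β) (α × β) ℂ} (hQ : Q.IsHermitian) :
    (partialTransposeB Q).IsHermitian := by
  ext p q
  exact hQ.apply (p.1, q.2) (q.1, p.2)

theorem partialTransposeA_zero : partialTransposeA (0 : Matrix (α × β) (α × β) ℂ) = 0 := rfl

theorem partialTransposeB_sum {κ : Type*} (s : Finset κ) (f : κ → Matrix (α × β) (α × β) ℂ) :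
    partialTransposeB (∑ i ∈ s, f i) = ∑ i ∈ s, partialTransposeB (f i) := by
  ext p q
  simp [partialTransposeB, Matrix.sum_apply]

variable [Fintype α] [Fintype β]

theorem dotProduct_partialTransposeB_mulVec (Q : Matrix (α × β) (α × β) ℂ) (ψ : α → ℂ)
    (φ : β → ℂ) : star (productVec ψ φ) ⬝ᵥ (partialTransposeB Q).mulVec (productVec ψ φ) =
      star (productVec ψ (star φ)) ⬝ᵥ Q.mulVec (productVec ψ (star φ)) := by
  simp only [dotProduct, mulVec, partialTransposeB, productVec, Fintype.sum_prod_type,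
    Finset.mul_sum, of_apply, Pi.star_apply, star_mul', star_star]
  refine Finset.sum_congr rfl fun x _ => ?_
  have swap (f : β → α → β → ℂ) : ∑ y, ∑ x', ∑ y', f y x' y' = ∑ y, ∑ x', ∑ y', f y' x' y := by
    rw [Finset.sum_comm]
    conv_rhs => rw [Finset.sum_comm]
    exact Finset.sum_congr rfl fun _ _ => Finset.sum_comm
  rw [swap]
  refine Finset.sum_congr rfl fun y _ => Finset.sum_congr rfl fun x' _ =>
    Finset.sum_congr rfl fun y' _ => ?_
  ring

/-- Partial transposes of positive semidefinite matrices are entanglement witnesses. -/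
theorem isWitness_partialTransposeB {Q : Matrix (α × β) (α × β) ℂ} (hQ : Q.PosSemidef) :
    IsWitness (partialTransposeB Q) := by
  refine ⟨partialTransposeB_isHermitian hQ.1, fun ψ φ => ?_⟩
  rw [dotProduct_partialTransposeB_mulVec]
  exact hQ.re_dotProduct_nonneg _

theorem isDecomposable_partialTransposeB {Q : Matrix (α × β) (α × β) ℂ} (hQ : Q.PosSemidef) :
    IsDecomposable (partialTransposeB Q) :=
  ⟨0, 0, Q, .zero, .zero, hQ, by simp [partialTransposeA_zero]⟩

end PartialTranspose

theorem conj_alice_partialTransposeB {α β α' : Type*} [Fintype β] [Fintype α']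
    [DecidableEq β] (K : Matrix α' α ℂ) (Q : Matrix (α' × β) (α' × β) ℂ) :
    (K ⊗ₖ (1 : Matrix β β ℂ)).conjTranspose * partialTransposeB Q * (K ⊗ₖ (1 : Matrix β β ℂ)) =
      partialTransposeB
        ((K ⊗ₖ (1 : Matrix β β ℂ)).conjTranspose * Q * (K ⊗ₖ (1 : Matrix β β ℂ))) := by
  ext ⟨p, p'⟩ ⟨q, q'⟩
  simp [partialTransposeB, mul_apply, Fintype.sum_prod_type, kroneckerMap_apply, one_apply,
    Finset.sum_mul, apply_ite]

/-- Transposing Bob's factor reverses products there, so his Kraus operator reappears entrywise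
conjugated; Alice's, acting on the other factor, is unchanged. -/
theorem conj_bob_partialTransposeB {α β β' : Type*} [Fintype α] [Fintype β']
    [DecidableEq α] (K : Matrix β' β ℂ) (Q : Matrix (α × β') (α × β') ℂ) :
    ((1 : Matrix α α ℂ) ⊗ₖ K).conjTranspose * partialTransposeB Q * ((1 : Matrix α α ℂ) ⊗ₖ K) =
      partialTransposeB (((1 : Matrix α α ℂ) ⊗ₖ K.map star).conjTranspose * Q *
        ((1 : Matrix α α ℂ) ⊗ₖ K.map star)) := by
  ext ⟨p, p'⟩ ⟨q, q'⟩
  simp [partialTransposeB, mul_apply, Fintype.sum_prod_type, kroneckerMap_apply, one_apply,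
    Finset.sum_mul, apply_ite]
  rw [Finset.sum_comm]
  refine Finset.sum_congr rfl fun x _ => Finset.sum_congr rfl fun y _ => ?_
  ring

/-! ### The adjoint of an LOCC protocol -/

/-- The adjoint (Heisenberg picture) of an LOCC protocol. -/
noncomputable def LOCCProtocol.dual {d e : ℕ} : {a b : ℕ} → LOCCProtocol d e a b →
    Matrix (Fin d × Fin e) (Fin d × Fin e) ℂ → Matrix (Fin a × Fin b) (Fin a × Fin b) ℂ
  | _, _, .halt, M => M
  | _, b, .alice _ _ K _ next, M => ∑ i,
      (K i ⊗ₖ (1 : Matrix (Fin b) (Fin b) ℂ)).conjTranspose * (next i).dual M *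
        (K i ⊗ₖ (1 : Matrix (Fin b) (Fin b) ℂ))
  | a, _, .bob _ _ K _ next, M => ∑ i,
      ((1 : Matrix (Fin a) (Fin a) ℂ) ⊗ₖ K i).conjTranspose * (next i).dual M *
        ((1 : Matrix (Fin a) (Fin a) ℂ) ⊗ₖ K i)

namespace LOCCProtocol

variable {d e a b : ℕ}

theorem trace_mul_conj {ι κ : Type*} [Fintype ι] [Fintype κ] (M : Matrix κ κ ℂ)
    (L : Matrix κ ι ℂ) (X : Matrix ι ι ℂ) :
    (M * (L * X * L.conjTranspose)).trace = (L.conjTranspose * M * L * X).trace := by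
  rw [← Matrix.mul_assoc, Matrix.trace_mul_comm]
  simp only [Matrix.mul_assoc]

theorem trace_mul_apply (P : LOCCProtocol d e a b) (M : Matrix (Fin d × Fin e) (Fin d × Fin e) ℂ)
    (X : Matrix (Fin a × Fin b) (Fin a × Fin b) ℂ) :
    (M * P.apply X).trace = (P.dual M * X).trace := by
  induction P with
  | halt => rfl
  | alice r c K hK next ih =>
    simp only [apply, dual, Finset.mul_sum, Finset.sum_mul, trace_sum, ih, trace_mul_conj]
  | bob r c K hK next ih =>
    simp only [apply, dual, Finset.mul_sum, Finset.sum_mul, trace_sum, ih, trace_mul_conj]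

theorem sum_kronecker {κ l m k o : Type*} (s : Finset κ) (f : κ → Matrix l m ℂ)
    (B : Matrix k o ℂ) : (∑ i ∈ s, f i) ⊗ₖ B = ∑ i ∈ s, f i ⊗ₖ B := by
  ext p q
  simp [Matrix.sum_apply, Finset.sum_mul]

theorem kronecker_sum {κ l m k o : Type*} (s : Finset κ) (f : κ → Matrix l m ℂ)
    (B : Matrix k o ℂ) : B ⊗ₖ (∑ i ∈ s, f i) = ∑ i ∈ s, B ⊗ₖ f i := by
  ext p q
  simp [Matrix.sum_apply, Finset.mul_sum]

/-- Unitality is the completeness of each local measurement, applied round by round. -/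
theorem dual_one (P : LOCCProtocol d e a b) : P.dual 1 = 1 := by
  induction P with
  | halt => rfl
  | alice r c K hK next ih =>
    simp only [dual, ih, Matrix.mul_one, conjTranspose_kronecker, ← mul_kronecker_mul,
      conjTranspose_one]
    rw [← sum_kronecker, hK, one_kronecker_one]
  | bob r c K hK next ih =>
    simp only [dual, ih, Matrix.mul_one, conjTranspose_kronecker, ← mul_kronecker_mul,
      conjTranspose_one]
    rw [← kronecker_sum, hK, one_kronecker_one]

theorem dual_sub (P : LOCCProtocol d e a b) (M N : Matrix (Fin d × Fin e) (Fin d × Fin e) ℂ) :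
    P.dual (M - N) = P.dual M - P.dual N := by
  induction P with
  | halt => rfl
  | alice r c K hK next ih => simp [dual, ih, Matrix.mul_sub, Matrix.sub_mul]
  | bob r c K hK next ih => simp [dual, ih, Matrix.mul_sub, Matrix.sub_mul]

theorem dual_smul (P : LOCCProtocol d e a b) (z : ℂ)
    (M : Matrix (Fin d × Fin e) (Fin d × Fin e) ℂ) : P.dual (z • M) = z • P.dual M := by
  induction P with
  | halt => rfl
  | alice r c K hK next ih => simp [dual, ih, Finset.smul_sum]
  | bob r c K hK next ih => simp [dual, ih, Finset.smul_sum]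

theorem dual_posSemidef (P : LOCCProtocol d e a b)
    {M : Matrix (Fin d × Fin e) (Fin d × Fin e) ℂ} (hM : M.PosSemidef) :
    (P.dual M).PosSemidef := by
  induction P with
  | halt => exact hM
  | alice r c K hK next ih =>
    exact posSemidef_sum _ fun i _ => (ih i).conjTranspose_mul_mul_same _
  | bob r c K hK next ih =>
    exact posSemidef_sum _ fun i _ => (ih i).conjTranspose_mul_mul_same _

/-- The adjoint of an LOCC protocol preserves the partial transposes of positive semidefinite
matrices. -/
theorem exists_dual_partialTransposeB (P : LOCCProtocol d e a b)
    {M : Matrix (Fin d × Fin e) (Fin d × Fin e) ℂ} (hM : M.PosSemidef) :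
    ∃ Q : Matrix (Fin a × Fin b) (Fin a × Fin b) ℂ, Q.PosSemidef ∧
      P.dual (partialTransposeB M) = partialTransposeB Q := by
  induction P with
  | halt => exact ⟨M, hM, rfl⟩
  | alice r c K hK next ih =>
    choose Q hQ h using ih
    refine ⟨_, posSemidef_sum Finset.univ fun i _ => (hQ i).conjTranspose_mul_mul_same (K i ⊗ₖ 1),
      ?_⟩
    simp only [dual, h, conj_alice_partialTransposeB, partialTransposeB_sum]
  | bob r c K hK next ih =>
    choose Q hQ h using ih
    refine ⟨_, posSemidef_sum Finset.univ fun i _ =>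
      (hQ i).conjTranspose_mul_mul_same (1 ⊗ₖ (K i).map star), ?_⟩
    simp only [dual, h, conj_bob_partialTransposeB, partialTransposeB_sum]

theorem trace_apply (P : LOCCProtocol d e a b) (X : Matrix (Fin a × Fin b) (Fin a × Fin b) ℂ) :
    (P.apply X).trace = X.trace := by
  simpa [dual_one] using P.trace_mul_apply 1 X

/-- The operators `|i₀⟩⟨i|` form a complete measurement that resets a system to the state `i₀`. -/
theorem sum_single_conjTranspose_mul_single {m k : ℕ} (i₀ : Fin m) :
    ∑ i : Fin k, (single i₀ i (1 : ℂ)).conjTranspose * single i₀ i (1 : ℂ) = 1 := by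
  ext p q
  simp only [Matrix.sum_apply, conjTranspose_single, single_mul_single_same, single_apply, star_one,
    mul_one, one_apply]
  by_cases h : p = q
  · simp [h]
  · rw [if_neg h]
    exact Finset.sum_eq_zero fun x _ => if_neg fun hx => h (hx.1.symm.trans hx.2)

/-- The parties may discard their systems and prepare a fixed product state. -/
theorem nonempty (hd : 1 ≤ d) (he : 1 ≤ e) : Nonempty (LOCCProtocol d e a b) :=
  ⟨.alice a (fun _ => d) (fun i => single ⟨0, hd⟩ i 1) (sum_single_conjTranspose_mul_single _)
    fun _ => .bob b (fun _ => e) (fun i => single ⟨0, he⟩ i 1)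
      (sum_single_conjTranspose_mul_single _) fun _ => .halt⟩

end LOCCProtocol

/-! ### The maximally entangled state -/

theorem inv_sqrt_mul_inv_sqrt (d : ℕ) :
    ((√(d : ℝ) : ℝ) : ℂ)⁻¹ * ((√(d : ℝ) : ℝ) : ℂ)⁻¹ = (d : ℂ)⁻¹ := by
  rw [← mul_inv, ← Complex.ofReal_mul, Real.mul_self_sqrt d.cast_nonneg, Complex.ofReal_natCast]

theorem dotProduct_maxEntangledVec {d : ℕ} (hd : 1 ≤ d) :
    star (maxEntangledVec d) ⬝ᵥ maxEntangledVec d = 1 := by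
  have : (0 : ℝ) < d := by exact_mod_cast hd
  have h := inv_sqrt_mul_inv_sqrt d
  have h0 : (d : ℂ) ≠ 0 := by exact_mod_cast this.ne'
  simp [dotProduct, maxEntangledVec, Fintype.sum_prod_type, apply_ite, h, h0]

theorem maxEntangled_isHermitian (d : ℕ) : (maxEntangled d).IsHermitian :=
  (posSemidef_vecMulVec_self_star _).1

theorem maxEntangled_mul_self {d : ℕ} (hd : 1 ≤ d) :
    maxEntangled d * maxEntangled d = maxEntangled d := by
  rw [maxEntangled, vecMulVec_mul_vecMulVec, dotProduct_maxEntangledVec hd]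
  simp

theorem trace_maxEntangled {d : ℕ} (hd : 1 ≤ d) : (maxEntangled d).trace = 1 := by
  rw [maxEntangled, trace_vecMulVec, dotProduct_comm, dotProduct_maxEntangledVec hd]

theorem one_sub_maxEntangled_posSemidef {d : ℕ} (hd : 1 ≤ d) :
    (1 - maxEntangled d).PosSemidef := by
  have h : 1 - maxEntangled d = (1 - maxEntangled d).conjTranspose * (1 - maxEntangled d) := by
    rw [conjTranspose_sub, conjTranspose_one, (maxEntangled_isHermitian d).eq]
    simp [sub_mul, mul_sub, maxEntangled_mul_self hd]
  rw [h]
  exact posSemidef_conjTranspose_mul_self _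

/-- The flip operator `ψ ⊗ φ ↦ φ ⊗ ψ`. -/
def flipMatrix (d : ℕ) : Matrix (Fin d × Fin d) (Fin d × Fin d) ℂ :=
  (1 : Matrix (Fin d × Fin d) (Fin d × Fin d) ℂ).submatrix id Prod.swap

theorem flipMatrix_mul_self (d : ℕ) : flipMatrix d * flipMatrix d = 1 := by
  ext ⟨p, p'⟩ ⟨q, q'⟩
  simp [flipMatrix, mul_apply, one_apply]

theorem flipMatrix_isHermitian (d : ℕ) : (flipMatrix d).IsHermitian := by
  ext ⟨p, p'⟩ ⟨q, q'⟩
  simp [flipMatrix, one_apply, apply_ite, and_comm, eq_comm]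

theorem one_sub_flipMatrix_posSemidef (d : ℕ) : (1 - flipMatrix d).PosSemidef := by
  -- As `F` is a Hermitian involution, `(1 - F)² = 2(1 - F)`.
  have h : 1 - flipMatrix d = (1 / 2 : ℝ) • ((1 - flipMatrix d).conjTranspose * (1 - flipMatrix d)) := by
    rw [conjTranspose_sub, conjTranspose_one, (flipMatrix_isHermitian d).eq]
    simp only [sub_mul, mul_sub, flipMatrix_mul_self, mul_one, one_mul]
    module
  rw [h]
  exact (posSemidef_conjTranspose_mul_self _).smul (by norm_num)

/-- Partial transposition exchanges `F` and `d P₊` and fixes the identity. This is the source of the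
factor `d` in the bound. -/
theorem one_sub_smul_maxEntangled {d : ℕ} (hd : 1 ≤ d) :
    1 - (d : ℂ) • maxEntangled d = partialTransposeB (1 - flipMatrix d) := by
  have : (0 : ℝ) < d := by exact_mod_cast hd
  have h := inv_sqrt_mul_inv_sqrt d
  have h0 : (d : ℂ) ≠ 0 := by exact_mod_cast this.ne'
  ext ⟨p, p'⟩ ⟨q, q'⟩
  simp only [partialTransposeB, flipMatrix, one_apply, maxEntangled, vecMulVec_apply,
    maxEntangledVec, Matrix.sub_apply, Matrix.smul_apply, of_apply, submatrix_apply, id,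
    Prod.swap_prod_mk, Prod.mk.injEq, Pi.star_apply, smul_eq_mul]
  have h1 : (d : ℂ) * ((√(d : ℝ) : ℂ)⁻¹ * (√(d : ℝ) : ℂ)⁻¹) = 1 := by rw [h, mul_inv_cancel₀ h0]
  by_cases hp : p = p' <;> by_cases hq : q = q' <;> simp [hp, hq, h1, eq_comm]

/-! ### The bound -/

open scoped MatrixOrder in
theorem Matrix.PosSemidef.trace_mul_nonneg {ι : Type*} [Fintype ι] {A B : Matrix ι ι ℂ}
    (hA : A.PosSemidef) (hB : B.PosSemidef) : 0 ≤ (A * B).trace := by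
  classical
  obtain ⟨C, rfl⟩ := CStarAlgebra.nonneg_iff_eq_star_mul_self.1 hA.nonneg
  rw [Matrix.mul_assoc, trace_mul_comm]
  exact (hB.mul_mul_conjTranspose_same C).trace_nonneg

/-- Bounds the witness values below, so that the `sInf` in `EPPT` is a true infimum and not the
default `0`. -/
theorem neg_le_re_trace_mul {α β : Type*} [Fintype α] [Fintype β] [DecidableEq α] [DecidableEq β]
    {n m : ℝ} {ρ W : Matrix (α × β) (α × β) ℂ} (hρ : IsDensity ρ)
    (hW : W ∈ pptWitnessSet α β n m) : -n ≤ (W * ρ).trace.re := by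
  have h : 0 ≤ ((W + (n : ℂ) • 1) * ρ).trace.re := by
    exact (Complex.le_def.1 (hW.2.2.1.trace_mul_nonneg hρ.1)).1
  simp [add_mul, hρ.2] at h
  linarith

theorem neg_re_trace_le_EPPT {α β : Type*} [Fintype α] [Fintype β] [DecidableEq α]
    [DecidableEq β] {n m : ℝ} {ρ W : Matrix (α × β) (α × β) ℂ} (hρ : IsDensity ρ)
    (hW : W ∈ pptWitnessSet α β n m) : -(W * ρ).trace.re ≤ EPPT n m ρ :=
  (neg_le_neg (csInf_le ⟨-n, by rintro _ ⟨V, hV, rfl⟩; exact neg_le_re_trace_mul hρ hV⟩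
    (Set.mem_image_of_mem _ hW))).trans (le_max_right _ _)

theorem dual_mem_pptWitnessSet {d a b : ℕ} (hd : 1 ≤ d) {n : ℝ} (hn : (d : ℝ) ≤ n)
    (P : LOCCProtocol d d a b) :
    P.dual (1 - (d : ℂ) • maxEntangled d) ∈ pptWitnessSet (Fin a) (Fin b) n 1 := by
  obtain ⟨Q, hQ, h⟩ := P.exists_dual_partialTransposeB (one_sub_flipMatrix_posSemidef d)
  rw [← one_sub_smul_maxEntangled hd] at h
  refine Set.mem_ofPred.2 ⟨h ▸ isWitness_partialTransposeB hQ,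
    h ▸ isDecomposable_partialTransposeB hQ, ?_, ?_⟩
  -- `W + n = d P†(1 - P₊) + (1 + n - d)`, and the last coefficient is nonnegative because `n ≥ d`.
  · have h1 : P.dual (1 - (d : ℂ) • maxEntangled d) + (n : ℂ) • 1 =
        (d : ℝ) • P.dual (1 - maxEntangled d) +
          (1 + n - d) • (1 : Matrix (Fin a × Fin b) (Fin a × Fin b) ℂ) := by
      simp only [P.dual_sub, P.dual_smul, P.dual_one, ← Complex.coe_smul]
      push_cast
      module
    rw [h1]
    exact ((P.dual_posSemidef (one_sub_maxEntangled_posSemidef hd)).smul (by positivity)).add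
      (PosSemidef.one.smul (by linarith))
  · have h1 : ((1 : ℝ) : ℂ) • 1 - P.dual (1 - (d : ℂ) • maxEntangled d) =
        (d : ℝ) • P.dual (maxEntangled d) := by
      simp only [P.dual_sub, P.dual_smul, P.dual_one, ← Complex.coe_smul]
      push_cast
      module
    rw [h1]
    exact (P.dual_posSemidef (posSemidef_vecMulVec_self_star _)).smul (by positivity)

theorem proposition6 (d a b : ℕ) (hd : 1 ≤ d)
    (ρ : Matrix (Fin a × Fin b) (Fin a × Fin b) ℂ) (hρ : IsDensity ρ)
    (n : ℝ) (hn : (d : ℝ) ≤ n) :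
    singleDistance d ρ ≥ 2 * (1 - (1 + EPPT n 1 ρ) / (d : ℝ)) := by
  -- Needed for `le_ciInf`: an infimum over no protocols would be `0` by default.
  have : Nonempty (LOCCProtocol d d a b) := LOCCProtocol.nonempty hd hd
  have hd0 : (0 : ℝ) < d := by exact_mod_cast hd
  refine le_ciInf fun P => le_trans ?_ (two_mul_one_sub_le_traceNorm (maxEntangled_isHermitian d)
    (maxEntangled_mul_self hd) (trace_maxEntangled hd) ((P.trace_apply ρ).trans hρ.2))
  -- Since `Tr ρ = 1`, this unfolds to `d Tr(P†(P₊) ρ) - 1 ≤ E_{n:1}(ρ)`.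
  have h := neg_re_trace_le_EPPT hρ (dual_mem_pptWitnessSet hd hn P)
  rw [P.trace_mul_apply]
  simp only [P.dual_sub, P.dual_smul, P.dual_one, sub_mul, one_mul, smul_mul_assoc, trace_sub,
    trace_smul, hρ.2] at h
  simp at h
  have : (P.dual (maxEntangled d) * ρ).trace.re ≤ (1 + EPPT n 1 ρ) / d := by
    rw [le_div_iff₀ hd0]
    linarith
  linarith
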